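/- Let $\mathcal P$ be a poset that is \emph{filtered}, i.e. there is a strictly order-preserving map $d\colon\mathcal P\to\mathbb N$, regarded as a category with a unique arrow $p\to q$ whenever $p\le q$, and let $R$ be a commutative unital ring. Let $\operatorname{Ch}(R)$ be the category of ($\mathbb Z$-graded) cochain complexes of $R$-modules. Equip $\operatorname{Fun}(\mathcal P^{\mathrm{op}},\operatorname{Ch}(R))$ with the model structure in which a natural transformation $\eta\colon X\to Y$ is a weak equivalence if $\eta_p\colon X(p)\to Y(p)$ is a quasi-isomorphism for every $p\in\mathcal P$, and a fibration if for every $p\in\mathcal P$ the induced map $$X(p)\longrightarrow Y(p)\times_{\lim_{\mathcal P_{<p}}Y}\lim_{\mathcal P_{<p}}X$$ is an epimorphism, where $\mathcal P_{<p}=\{q\in\mathcal P\mid q<p\}$ (the cofibrations are the objectwise cofibrations of the projective model structure on $\operatorname{Ch}(R)$). An object $X$ is fibrant if the map $X\to 0$ to the terminal object is a fibration, and a fibrant replacement of $X$ is a weak equivalence $X\to \mathbf R X$ with $\mathbf R X$ fibrant. Let $F\colon\mathcal P^{\mathrm{op}}\to R\text{-}\mathrm{Mod}$ be a functor, regarded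 as a functor to $\operatorname{Ch}(R)$ concentrated in degree $0$, and let $F\to\mathbf R F$ be any fibrant replacement of $F$. Then there are isomorphisms of $R$-modules $$H^n(\mathcal P;F):=(R^n\lim)(F)\;\cong\;H^n\bigl(\lim_{\mathcal P^{\mathrm{op}}}\mathbf R F\bigr)\qquad(n\ge 0),$$ where $R^n\lim$ is the $n$-th right derived functor of $\lim\colon\operatorname{Fun}(\mathcal P^{\mathrm{op}},R\text{-}\mathrm{Mod})\to R\text{-}\mathrm{Mod}$, and $H^n(\lim_{\mathcal P^{\mathrm{op}}}\mathbf R F)=0$ for $n<0$. -/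

import Mathlib

open CategoryTheory CategoryTheory.Limits Opposite

universe u

noncomputable section

namespace HigherLim

/-- A poset is filtered if it admits a strictly order-preserving map to `ℕ`. (This is unrelated
to the notion of a filtered category.) -/
def IsFilteredPoset (P : Type u) [PartialOrder P] : Prop :=
  ∃ d : P → ℕ, StrictMono d

/-- `Ch(R)`: unbounded (`ℤ`-graded) cochain complexes of `R`-modules. -/
abbrev Ch (R : Type u) [CommRing R] :=
  CochainComplex (ModuleCat.{u} R) ℤ

section

variable {P : Type u} [PartialOrder P] {R : Type u} [CommRing R]

/-- The inclusion `(P_{< p})ᵒᵖ ⥤ Pᵒᵖ`, where `P_{< p} = {q | q < p}`. -/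
abbrev inclLT (p : P) : (Set.Iio p)ᵒᵖ ⥤ Pᵒᵖ :=
  (Monotone.functor (f := fun q : Set.Iio p => (q : P)) fun _ _ h => h).op

/-- The matching object `lim_{P_{< p}} X`. -/
abbrev matchingObj (X : Pᵒᵖ ⥤ Ch R) (p : P) : Ch R :=
  limit (inclLT p ⋙ X)

/-- The map `lim_{P_{< p}} X ⟶ lim_{P_{< p}} Y` induced by `η : X ⟶ Y`. -/
abbrev matchingObjMap {X Y : Pᵒᵖ ⥤ Ch R} (η : X ⟶ Y) (p : P) :
    matchingObj X p ⟶ matchingObj Y p :=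
  limMap (Functor.whiskerLeft (inclLT p) η)

/-- The matching map `X(p) ⟶ lim_{P_{< p}} X`, whose components are the structure maps
`X(p) ⟶ X(q)` for `q < p`. -/
def matchingMap (X : Pᵒᵖ ⥤ Ch R) (p : P) : X.obj (op p) ⟶ matchingObj X p :=
  limit.lift (inclLT p ⋙ X)
    { pt := X.obj (op p)
      π :=
        { app := fun q => X.map (homOfLE (le_of_lt (show (q.unop : P) < p from q.unop.2))).op
          naturality := fun q q' f => by
            refine (Category.id_comp _).trans ?_
            exact X.map_comp (homOfLE (le_of_lt (show (q.unop : P) < p from q.unop.2))).op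
              ((inclLT p).map f) } }

lemma matchingMap_naturality {X Y : Pᵒᵖ ⥤ Ch R} (η : X ⟶ Y) (p : P) :
    η.app (op p) ≫ matchingMap Y p = matchingMap X p ≫ matchingObjMap η p := by
  apply limit.hom_ext
  intro q
  simp only [matchingMap, matchingObjMap, Category.assoc, limMap_π, limit.lift_π,
    limit.lift_π_assoc]
  exact (η.naturality _).symm

/-- The relative matching map `X(p) ⟶ Y(p) ×_{lim_{P_{< p}} Y} lim_{P_{< p}} X` of `η : X ⟶ Y`. -/
def relMatchingMap {X Y : Pᵒᵖ ⥤ Ch R} (η : X ⟶ Y) (p : P) :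
    X.obj (op p) ⟶ pullback (matchingMap Y p) (matchingObjMap η p) :=
  pullback.lift (η.app (op p)) (matchingMap X p) (matchingMap_naturality η p)

variable (P R)

/-- The weak equivalences of `Fun(Pᵒᵖ, Ch(R))` are the objectwise quasi-isomorphisms. -/
instance : HomotopicalAlgebra.CategoryWithWeakEquivalences (Pᵒᵖ ⥤ Ch R) where
  weakEquivalences := fun _ _ η => ∀ p : P, QuasiIso (η.app (op p))

/-- The fibrations of `Fun(Pᵒᵖ, Ch(R))` are the natural transformations all of whose relative
matching maps are epimorphisms. -/
instance : HomotopicalAlgebra.CategoryWithFibrations (Pᵒᵖ ⥤ Ch R) where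
  fibrations := fun _ _ η => ∀ p : P, Epi (relMatchingMap η p)

variable {P R}

/-- A functor `Pᵒᵖ ⥤ R-Mod` regarded as a functor to `Ch(R)` concentrated in degree `0`. -/
abbrev inDegreeZero (F : Pᵒᵖ ⥤ ModuleCat.{u} R) : Pᵒᵖ ⥤ Ch R :=
  F ⋙ HomologicalComplex.single (ModuleCat.{u} R) (ComplexShape.up ℤ) 0

/-- `RF` together with `ι : X ⟶ RF` is a fibrant replacement of `X`: the object `RF` is fibrant
(`RF ⟶ ⊤_` is a fibration) and `ι` is a weak equivalence. -/
structure IsFibrantReplacement {X RF : Pᵒᵖ ⥤ Ch R} (ι : X ⟶ RF) : Prop where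
  weakEquivalence : HomotopicalAlgebra.WeakEquivalence ι
  isFibrant : HomotopicalAlgebra.IsFibrant RF

end

/-- `Fun(Pᵒᵖ, R-Mod)` is a Grothendieck abelian category; in particular it has enough injectives,
so right derived functors are defined on it. -/
instance {P : Type u} [PartialOrder P] {R : Type u} [CommRing R] :
    IsGrothendieckAbelian.{u} (Pᵒᵖ ⥤ ModuleCat.{u} R) where
  hasFilteredColimitsOfSize := ⟨fun _ _ _ => inferInstance⟩
  ab5OfSize := ⟨fun _ _ _ => inferInstance⟩
  hasSeparator := Presheaf.hasSeparator _ _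

instance {P : Type u} [PartialOrder P] {R : Type u} [CommRing R] :
    (lim : (Pᵒᵖ ⥤ ModuleCat.{u} R) ⥤ ModuleCat.{u} R).Additive where
  map_add := by
    intro X Y f g
    apply limit.hom_ext
    intro j
    simp

/-- The higher limit `H^n(P; F) = R^n lim F`, the `n`-th right derived functor of
`lim : Fun(Pᵒᵖ, R-Mod) ⥤ R-Mod` evaluated at `F`. -/
def higherLimit {P : Type u} [PartialOrder P] {R : Type u} [CommRing R]
    (F : Pᵒᵖ ⥤ ModuleCat.{u} R) (n : ℕ) : ModuleCat.{u} R :=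
  ((lim : (Pᵒᵖ ⥤ ModuleCat.{u} R) ⥤ ModuleCat.{u} R).rightDerived n).obj F

end HigherLim

end

/-! Call a presheaf flasque if its matching maps are surjective. An injective resolution `I` of `F`
and the replacement `RF` are both complexes of flasque presheaves quasi-isomorphic to `F`:
injectives are flasque (`isFlasque_of_injective`), and fibrancy says exactly that each degree is
flasque. Since `I` is K-injective, `F ⟶ I` extends up to homotopy along `F ⟶ RF` to a
quasi-isomorphism `φ : RF ⟶ I`, whose cone is acyclic and degreewise flasque. The heart is
`acyclic_lim`: over a well-founded poset the limit of such a complex is acyclic. The induction runs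
over the poset, with all degrees at once, so no boundedness is needed although `RF` may be
unbounded. Hence `lim φ` is a quasi-isomorphism, and `lim I` computes `R^n lim F` and vanishes in
negative degrees. -/

noncomputable section

namespace HigherLim

/-! ### Flasque presheaves and acyclicity of limits -/

section Flasque

variable {P : Type u} [PartialOrder P] {R : Type u} [CommRing R]

/-- The restriction map `G(q) → G(p)` of a presheaf `G` on a poset, for `p ≤ q`. -/
def res (G : Pᵒᵖ ⥤ ModuleCat.{u} R) {p q : P} (h : p ≤ q) :
    G.obj (op q) →ₗ[R] G.obj (op p) :=
  (G.map (homOfLE h).op).hom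

lemma res_refl (G : Pᵒᵖ ⥤ ModuleCat.{u} R) (p : P) (x : G.obj (op p)) :
    res G (le_refl p) x = x :=
  congrArg (fun f => f.hom x) (G.map_id (op p))

lemma res_res (G : Pᵒᵖ ⥤ ModuleCat.{u} R) {p q r : P} (h : p ≤ q) (h' : q ≤ r)
    (x : G.obj (op r)) : res G h (res G h' x) = res G (h.trans h') x :=
  (congrArg (fun f => f.hom x) (G.map_comp (homOfLE h').op (homOfLE h).op)).symm

lemma app_res {G H : Pᵒᵖ ⥤ ModuleCat.{u} R} (f : G ⟶ H) {p q : P} (h : p ≤ q)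
    (x : G.obj (op q)) : (f.app (op p)).hom (res G h x) = res H h ((f.app (op q)).hom x) :=
  congrArg (fun f => f.hom x) (f.naturality (homOfLE h).op)

/-- A family of elements of `G` is compatible on `U` if it is a section of `G` over `U`. -/
def Compatible (G : Pᵒᵖ ⥤ ModuleCat.{u} R) (U : Set P) (s : ∀ q, G.obj (op q)) : Prop :=
  ∀ ⦃q q' : P⦄ (h : q ≤ q'), q' ∈ U → res G h (s q') = s q

lemma Compatible.map {G H : Pᵒᵖ ⥤ ModuleCat.{u} R} {U : Set P} {s : ∀ q, G.obj (op q)}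
    (hs : Compatible G U s) (f : G ⟶ H) :
    Compatible H U (fun q => (f.app (op q)).hom (s q)) := by
  intro q q' h hq'
  rw [← app_res, hs h hq']

lemma compatible_res (G : Pᵒᵖ ⥤ ModuleCat.{u} R) (p : P) (x : G.obj (op p)) :
    ∃ s : ∀ q, G.obj (op q), Compatible G (Set.Iio p) s ∧
      ∀ ⦃q⦄ (hq : q < p), s q = res G hq.le x := by
  classical
  refine ⟨fun q => if h : q < p then res G h.le x else 0, ?_, fun q hq => by simp [hq]⟩
  intro q q' h hq'
  have h1 : q' < p := hq'
  simp [h1, h.trans_lt h1, res_res]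

/-- A presheaf of modules on a poset is flasque if every section over `P_{< p}` extends to `p`,
that is, if its matching maps are surjective. -/
def IsFlasque (G : Pᵒᵖ ⥤ ModuleCat.{u} R) : Prop :=
  ∀ (p : P) (s : ∀ q, G.obj (op q)), Compatible G (Set.Iio p) s →
    ∃ x : G.obj (op p), ∀ ⦃q⦄ (hq : q < p), res G hq.le x = s q

/-- A presheaf which, as far as elements go, is a sum of two flasque presheaves is flasque. -/
lemma IsFlasque.of_decomposition {A B G : Pᵒᵖ ⥤ ModuleCat.{u} R} (hA : IsFlasque A)
    (hB : IsFlasque B) (i₁ : A ⟶ G) (i₂ : B ⟶ G) (r₁ : G ⟶ A) (r₂ : G ⟶ B)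
    (h : r₁ ≫ i₁ + r₂ ≫ i₂ = 𝟙 G) : IsFlasque G := by
  intro p s hs
  obtain ⟨a, ha⟩ := hA p _ (hs.map r₁)
  obtain ⟨b, hb⟩ := hB p _ (hs.map r₂)
  refine ⟨(i₁.app (op p)).hom a + (i₂.app (op p)).hom b, fun q hq => ?_⟩
  rw [map_add, ← app_res, ← app_res, ha hq, hb hq]
  exact congrArg (fun f => (f.app (op q)).hom (s q)) h

variable (K : CochainComplex (Pᵒᵖ ⥤ ModuleCat.{u} R) ℤ)

/-- Every section over `U` of the presheaf of cocycles is the differential of a section. -/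
def SectionsExact (U : Set P) : Prop :=
  ∀ ⦃i j k : ℤ⦄, i + 1 = j → j + 1 = k → ∀ z : ∀ q, (K.X j).obj (op q), Compatible (K.X j) U z →
    (∀ q ∈ U, ((K.d j k).app (op q)).hom (z q) = 0) →
    ∃ y : ∀ q, (K.X i).obj (op q), Compatible (K.X i) U y ∧
      ∀ q ∈ U, ((K.d i j).app (op q)).hom (y q) = z q

/-- Cocycles at `p` vanishing below `p` are differentials of elements vanishing below `p`. -/
def RelativeExact (p : P) : Prop :=
  ∀ ⦃i j k : ℤ⦄, i + 1 = j → j + 1 = k → ∀ z : (K.X j).obj (op p),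
    (∀ ⦃q⦄ (hq : q < p), res (K.X j) hq.le z = 0) → ((K.d j k).app (op p)).hom z = 0 →
    ∃ y : (K.X i).obj (op p), (∀ ⦃q⦄ (hq : q < p), res (K.X i) hq.le y = 0) ∧
      ((K.d i j).app (op p)).hom y = z

/-- Objectwise exactness, in terms of elements. -/
def ObjectwiseExact : Prop :=
  ∀ (p : P) ⦃i j k : ℤ⦄, i + 1 = j → j + 1 = k → ∀ z : (K.X j).obj (op p),
    ((K.d j k).app (op p)).hom z = 0 → ∃ y, ((K.d i j).app (op p)).hom y = z

variable {K}

lemma d_d_apply (i j k : ℤ) (p : P) (x : (K.X i).obj (op p)) :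
    ((K.d j k).app (op p)).hom (((K.d i j).app (op p)).hom x) = 0 :=
  congrArg (fun f => (f.app (op p)).hom x) (K.d_comp_d i j k)

/-- A primitive `y` of `z` restricts below `p` to a cocycle, hence to the differential of a section
`w`. Flasqueness extends `w` to `p`, and subtracting its differential makes `y` vanish below `p`. -/
lemma relativeExact_of_sectionsExact (hK : ∀ n, IsFlasque (K.X n)) (hex : ObjectwiseExact K)
    (p : P) (hp : SectionsExact K (Set.Iio p)) : RelativeExact K p := by
  intro i j k hij hjk z hz hdz
  obtain ⟨y, rfl⟩ := hex p hij hjk z hdz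
  obtain ⟨s, hs, hsy⟩ := compatible_res (K.X i) p y
  obtain ⟨w, hw, hdw⟩ := hp (sub_add_cancel i 1) hij s hs (fun q hq => by
    rw [hsy hq, app_res, hz hq])
  obtain ⟨w', hw'⟩ := hK _ p w hw
  refine ⟨y - ((K.d (i - 1) i).app (op p)).hom w', fun q hq => ?_, ?_⟩
  · rw [map_sub, ← app_res, hw' hq, hdw q hq, hsy hq, sub_self]
  · rw [map_sub, d_d_apply, sub_zero]

/-- The primitive is built by well-founded recursion: its values below `p` extend to some `x` at
`p`, and the error `dx - z` is a cocycle vanishing below `p`, which relative exactness removes. -/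
lemma sectionsExact_of_relativeExact [WellFoundedLT P] (hK : ∀ n, IsFlasque (K.X n))
    (U : Set P) (hU : IsLowerSet U) (h : ∀ p ∈ U, RelativeExact K p) :
    SectionsExact K U := by
  classical
  intro i j k hij hjk z hz hdz
  let Good (p : P) (y : ∀ q, q < p → (K.X i).obj (op q)) (x : (K.X i).obj (op p)) : Prop :=
    (∀ q (hq : q < p), res (K.X i) hq.le x = y q hq) ∧ ((K.d i j).app (op p)).hom x = z p
  let step (p : P) (y : ∀ q, q < p → (K.X i).obj (op q)) : (K.X i).obj (op p) :=
    -- The recursion must be defined before solvability is known; `good` shows that the default 0 is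
    -- never used on `U`.
    if hx : ∃ x, Good p y x then hx.choose else 0
  let y : ∀ p, (K.X i).obj (op p) := wellFounded_lt.fix step
  have hy (p : P) : y p = step p (fun q _ => y q) := wellFounded_lt.fix_eq _ _
  have good (p : P) : p ∈ U → Good p (fun q _ => y q) (y p) := by
    induction p using WellFoundedLT.induction with
    | ind p ih =>
    intro hp
    have hc : Compatible (K.X i) (Set.Iio p) y := by
      intro q q' hqq' hq'
      obtain rfl | hlt := hqq'.eq_or_lt
      · exact res_refl _ _ _
      · exact (ih q' hq' (hU (le_of_lt hq') hp)).1 q hlt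
    obtain ⟨x, hx⟩ := hK i p y hc
    obtain ⟨m, hm, hdm⟩ := h p hp hij hjk (((K.d i j).app (op p)).hom x - z p)
      (fun q hq => by
        rw [map_sub, ← app_res, hx hq, hz hq.le hp, (ih q hq (hU hq.le hp)).2, sub_self])
      (by rw [map_sub, d_d_apply, hdz p hp, sub_zero])
    have hex : ∃ x, Good p (fun q _ => y q) x :=
      ⟨x - m, fun q hq => by rw [map_sub, hx hq, hm hq, sub_zero],
        by rw [map_sub, hdm, sub_sub_cancel]⟩
    rw [hy p]
    simp only [step, dif_pos hex]
    exact hex.choose_spec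
  refine ⟨y, fun q q' hqq' hq' => ?_, fun q hq => (good q hq).2⟩
  obtain rfl | hlt := hqq'.eq_or_lt
  · exact res_refl _ _ _
  · exact (good q' hq').1 q hlt

/-- The two preceding lemmas alternate: relative exactness at all `q < p` gives exactness on
sections over `P_{< p}`, hence relative exactness at `p`. -/
lemma sectionsExact_univ [WellFoundedLT P] (hK : ∀ n, IsFlasque (K.X n))
    (hex : ObjectwiseExact K) : SectionsExact K Set.univ := by
  refine sectionsExact_of_relativeExact hK _ isLowerSet_univ (fun p _ => ?_)
  induction p using WellFoundedLT.induction with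
  | ind p ih =>
  exact relativeExact_of_sectionsExact hK hex p
    (sectionsExact_of_relativeExact hK _ (isLowerSet_Iio p)
      fun q hq => ih q hq trivial)

lemma exists_of_compatible (G : Pᵒᵖ ⥤ ModuleCat.{u} R) {s : ∀ q, G.obj (op q)}
    (hs : Compatible G Set.univ s) :
    ∃ x : (limit G : ModuleCat.{u} R), ∀ q, (limit.π G (op q)).hom x = s q := by
  let t : (G ⋙ forget (ModuleCat.{u} R)).sections :=
    ⟨fun q => s q.unop, fun {q q'} f => hs (leOfHom f.unop) (Set.mem_univ _)⟩
  let hl := isLimitOfPreserves (forget (ModuleCat.{u} R)) (limit.isLimit G)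
  refine ⟨(Types.isLimitEquivSections hl).symm t, fun q => ?_⟩
  exact Types.isLimitEquivSections_symm_apply hl t (op q)

lemma compatible_π (G : Pᵒᵖ ⥤ ModuleCat.{u} R) (x : (limit G : ModuleCat.{u} R)) :
    Compatible G Set.univ (fun q => (limit.π G (op q)).hom x) := by
  intro q q' h _
  exact congrArg (fun f => f.hom x) (limit.w G (homOfLE h).op)

/-- The limit of an acyclic (possibly unbounded) complex of flasque presheaves is acyclic. -/
lemma acyclic_lim [WellFoundedLT P] (hK : ∀ n, IsFlasque (K.X n)) (hex : K.Acyclic) :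
    (((lim : (Pᵒᵖ ⥤ ModuleCat.{u} R) ⥤ _).mapHomologicalComplex _).obj K).Acyclic := by
  have hex' : ObjectwiseExact K := by
    intro p i j k hij hjk z hz
    have h1 := (K.exactAt_iff' i j k (by simp; lia) (by simp; lia)).1 (hex j)
    have h2 := h1.map ((evaluation _ _).obj (op p))
    exact (ShortComplex.moduleCat_exact_iff _).1 h2 z hz
  intro j
  rw [HomologicalComplex.exactAt_iff' _ (j - 1) j (j + 1) (by simp) (by simp),
    ShortComplex.moduleCat_exact_iff]
  intro z hz
  have hcomm (i k : ℤ) (q : P) (x : (limit (K.X i) : ModuleCat.{u} R)) :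
      (limit.π (K.X k) (op q)).hom ((lim.map (K.d i k)).hom x) =
        ((K.d i k).app (op q)).hom ((limit.π (K.X i) (op q)).hom x) :=
    congrArg (fun f => f.hom x) (limMap_π (K.d i k) (op q))
  obtain ⟨y, hy, hdy⟩ := sectionsExact_univ hK hex' (sub_add_cancel j 1) rfl _
    (compatible_π (K.X j) z) (fun q _ => by
      exact (hcomm _ _ q z).symm.trans
        ((congrArg (limit.π (K.X (j + 1)) (op q)).hom hz).trans (map_zero _)))
  obtain ⟨x, hx⟩ := exists_of_compatible _ hy
  refine ⟨x, Concrete.limit_ext _ _ _ fun q => ?_⟩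
  exact (hcomm _ _ q.unop x).trans ((congrArg _ (hx q.unop)).trans (hdy q.unop trivial))

end Flasque


/-! ### Injective presheaves are flasque -/

section Injective

variable {P : Type u} [PartialOrder P] (R : Type u) [CommRing R]

/-- The indicator presheaf of a lower set. -/
def indicator (U : LowerSet P) : Pᵒᵖ ⥤ Type u where
  obj q := ULift.{u} (PLift (q.unop ∈ U))
  map f := TypeCat.ofHom fun h => ⟨⟨U.lower (leOfHom f.unop) h.down.down⟩⟩

/-- The inclusion between indicator presheaves given by an inclusion of lower sets. -/
def indicatorMap {U V : LowerSet P} (h : U ≤ V) : indicator U ⟶ indicator V where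
  app _ := TypeCat.ofHom fun x => ⟨⟨h x.down.down⟩⟩

/-- The presheaf which is `R` on a lower set, and zero elsewhere. -/
def freeOn (U : LowerSet P) : Pᵒᵖ ⥤ ModuleCat.{u} R :=
  indicator U ⋙ ModuleCat.free R

/-- The inclusion between the presheaves `freeOn` given by an inclusion of lower sets. -/
def freeOnMap {U V : LowerSet P} (h : U ≤ V) : freeOn R U ⟶ freeOn R V :=
  Functor.whiskerRight (indicatorMap h) (ModuleCat.free R)

lemma mono_freeOnMap {U V : LowerSet P} (h : U ≤ V) : Mono (freeOnMap R h) := by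
  have (q : Pᵒᵖ) : Mono ((freeOnMap R h).app q) := by
    rw [ModuleCat.mono_iff_injective]
    exact Finsupp.mapDomain_injective fun (x y : ULift (PLift _)) _ => Subsingleton.elim x y
  exact NatTrans.mono_of_mono_app _

variable {R}

/-- The morphism from `freeOn R U` given by a section over `U`. -/
def freeOnDesc {G : Pᵒᵖ ⥤ ModuleCat.{u} R} (U : LowerSet P) (s : ∀ q, G.obj (op q))
    (hs : Compatible G U s) : freeOn R U ⟶ G where
  app q := ModuleCat.freeDesc (TypeCat.ofHom fun _ => s q.unop)
  naturality q q' f := by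
    refine ModuleCat.free_hom_ext fun x => ?_
    have h1 := hs (leOfHom f.unop) x.down.down
    have h2 : (freeOn R U).map f (ModuleCat.freeMk x) =
      ModuleCat.freeMk (R := R) ((indicator U).map f x) := ModuleCat.free_map_apply _ _
    refine (congrArg (ModuleCat.freeDesc (TypeCat.ofHom fun _ => s q'.unop)).hom h2).trans ?_
    refine (ModuleCat.freeDesc_apply _ _).trans (h1.symm.trans ?_)
    exact congrArg (G.map f).hom 
      (ModuleCat.freeDesc_apply (R := R) (TypeCat.ofHom fun _ => s q.unop) x).symm

/-- A section over `P_{< p}` is a morphism from `freeOn` of that lower set. Injectivity extends it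
to `freeOn` of `P_{≤ p}`, and the image of the generator at `p` is the required element. -/
lemma isFlasque_of_injective (G : Pᵒᵖ ⥤ ModuleCat.{u} R) [Injective G] : IsFlasque G := by
  intro p s hs
  let f : freeOn R (LowerSet.Iio p) ⟶ G := freeOnDesc _ s hs
  let i : freeOn R (LowerSet.Iio p) ⟶ freeOn R (LowerSet.Iic p) :=
    freeOnMap R (U := LowerSet.Iio p) (V := LowerSet.Iic p) (fun _ h => le_of_lt h)
  have : Mono i := mono_freeOnMap R _
  let g := Injective.factorThru f i
  have hg : i ≫ g = f := Injective.comp_factorThru f i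
  let x (q : P) (hq : q ≤ p) : (freeOn R (LowerSet.Iic p)).obj (op q) :=
    ModuleCat.freeMk (R := R) (X := (indicator (LowerSet.Iic p)).obj (op q)) ⟨⟨hq⟩⟩
  refine ⟨(g.app (op p)).hom (x p le_rfl), fun q hq => ?_⟩
  rw [← app_res]
  have h1 : res _ hq.le (x p le_rfl) = x q hq.le := ModuleCat.free_map_apply _ _
  let y : (freeOn R (LowerSet.Iio p)).obj (op q) :=
    ModuleCat.freeMk (R := R) (X := (indicator (LowerSet.Iio p)).obj (op q)) ⟨⟨hq⟩⟩
  have h2 : (i.app (op q)).hom y = x q hq.le := ModuleCat.free_map_apply _ _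
  have h3 : (f.app (op q)).hom y = s q := ModuleCat.freeDesc_apply _ _
  rw [h1, ← h2, ← h3, ← hg]
  rfl

end Injective

/-! ### Functors to complexes, and fibrancy as flasqueness -/

section ComplexOfFunctor

variable {P : Type u} [PartialOrder P] {R : Type u} [CommRing R]

/-- A functor to complexes gives a complex of functors. -/
@[simps]
def complexOfFunctor (X : Pᵒᵖ ⥤ Ch R) : CochainComplex (Pᵒᵖ ⥤ ModuleCat.{u} R) ℤ where
  X n := X ⋙ HomologicalComplex.eval _ _ n
  d i j := { app := fun p => (X.obj p).d i j, naturality := fun _ _ f => (X.map f).comm i j }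
  shape i j h := by ext p : 2; exact (X.obj p).shape i j h
  d_comp_d' i j k _ _ := by ext p : 2; exact (X.obj p).d_comp_d i j k

/-- The functoriality of `complexOfFunctor`. -/
@[simps]
def complexOfFunctorMap {X Y : Pᵒᵖ ⥤ Ch R} (η : X ⟶ Y) :
    complexOfFunctor X ⟶ complexOfFunctor Y where
  f n := Functor.whiskerRight η _
  comm' i j _ := by ext p : 2; exact (η.app p).comm i j

/-- The limit of complexes is computed degreewise. -/
def limitIso (X : Pᵒᵖ ⥤ Ch R) :
    ((lim : (Pᵒᵖ ⥤ ModuleCat.{u} R) ⥤ _).mapHomologicalComplex _).obj (complexOfFunctor X) ≅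
      limit X :=
  (HomologicalComplex.isLimitConeOfHasLimitEval X).conePointUniqueUpToIso (limit.isLimit X)

lemma quasiIso_complexOfFunctorMap {X Y : Pᵒᵖ ⥤ Ch R} (η : X ⟶ Y)
    (h : HomotopicalAlgebra.WeakEquivalence η) : QuasiIso (complexOfFunctorMap η) := by
  rw [HomologicalComplex.quasiIso_iff_evaluation]
  exact fun p => h.mem p.unop

/-- The degree zero part of a presheaf regarded as a complex in degree zero. -/
def inDegreeZeroXIso (F : Pᵒᵖ ⥤ ModuleCat.{u} R) :
    F ≅ (complexOfFunctor (inDegreeZero F)).X 0 :=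
  F.rightUnitor.symm ≪≫ Functor.isoWhiskerLeft F
    (HomologicalComplex.singleCompEvalIsoSelf (ModuleCat.{u} R) (ComplexShape.up ℤ) 0).symm

/-- A presheaf of modules regarded as a complex of presheaves in degree zero. -/
def singleToComplexOfFunctor (F : Pᵒᵖ ⥤ ModuleCat.{u} R) :
    (HomologicalComplex.single _ (ComplexShape.up ℤ) 0).obj F ⟶
      complexOfFunctor (inDegreeZero F) :=
  HomologicalComplex.mkHomFromSingle (inDegreeZeroXIso F).hom (fun k hk => by
    have hk' : k ≠ 0 := by rintro rfl; simp at hk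
    refine IsZero.eq_of_tgt ((Functor.isZero_iff _).2 fun p => ?_) _ _
    exact HomologicalComplex.isZero_single_obj_X (.up ℤ) 0 (F.obj p) k hk')

instance (F : Pᵒᵖ ⥤ ModuleCat.{u} R) : IsIso (singleToComplexOfFunctor F) := by
  have (n : ℤ) : IsIso ((singleToComplexOfFunctor F).f n) := by
    by_cases hn : n = 0
    · subst hn
      rw [singleToComplexOfFunctor, HomologicalComplex.mkHomFromSingle_f]
      infer_instance
    · have h1 : IsZero (((HomologicalComplex.single (Pᵒᵖ ⥤ ModuleCat.{u} R)
          (ComplexShape.up ℤ) 0).obj F).X n) := HomologicalComplex.isZero_single_obj_X _ _ _ _ hn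
      have h2 : IsZero ((complexOfFunctor (inDegreeZero F)).X n) := by
        rw [Functor.isZero_iff]
        exact fun p => HomologicalComplex.isZero_single_obj_X (.up ℤ) 0 (F.obj p) n hn
      exact h1.isIso h2 _
  exact HomologicalComplex.Hom.isIso_of_components _

/-- Over the terminal object the pullback is taken along a map of zero objects, so its projection to
the matching object is an isomorphism. -/
lemma epi_matchingMap (X : Pᵒᵖ ⥤ Ch R) (hX : HomotopicalAlgebra.IsFibrant X) (p : P) :
    Epi (matchingMap X p) := by
  have h : Epi (relMatchingMap (terminal.from X) p) := hX.mem p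
  have h1 : IsZero ((⊤_ (Pᵒᵖ ⥤ Ch R)).obj (op p)) :=
    (Functor.isZero_iff _).1 ((isZero_zero _).of_iso (HasZeroObject.zeroIsoTerminal).symm) _
  have h2 : IsZero (matchingObj (⊤_ (Pᵒᵖ ⥤ Ch R)) p) := by
    rw [IsZero.iff_id_eq_zero]
    apply limit.hom_ext
    intro q
    exact ((Functor.isZero_iff _).1
      ((isZero_zero _).of_iso (HasZeroObject.zeroIsoTerminal).symm) _).eq_of_tgt _ _
  have : IsIso (matchingMap (⊤_ (Pᵒᵖ ⥤ Ch R)) p) := h1.isIso h2 _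
  have h3 : relMatchingMap (terminal.from X) p ≫ pullback.snd _ _ = matchingMap X p :=
    pullback.lift_snd _ _ _
  rw [← h3]
  infer_instance

/-- Limits and epimorphisms of complexes are degreewise, so a section over `P_{< p}` in degree `n`
is an element of the matching object and lifts. -/
lemma isFlasque_complexOfFunctor_X (X : Pᵒᵖ ⥤ Ch R) (hX : HomotopicalAlgebra.IsFibrant X)
    (n : ℤ) : IsFlasque ((complexOfFunctor X).X n) := by
  intro p s hs
  have := epi_matchingMap X hX p
  have hsurj : Function.Surjective ((matchingMap X p).f n).hom :=
    (ModuleCat.epi_iff_surjective _).1 inferInstance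
  let ev : Ch R ⥤ Type u := HomologicalComplex.eval _ _ n ⋙ forget (ModuleCat.{u} R)
  let t : ((inclLT p ⋙ X) ⋙ ev).sections :=
    ⟨fun q => s q.unop, fun {q q'} f => hs (leOfHom f.unop) q.unop.2⟩
  let hl := isLimitOfPreserves ev (limit.isLimit (inclLT p ⋙ X))
  obtain ⟨x, hx⟩ := hsurj ((Types.isLimitEquivSections hl).symm t)
  refine ⟨x, fun q hq => ?_⟩
  have h1 := Types.isLimitEquivSections_symm_apply hl t (op ⟨q, hq⟩)
  have h2 : matchingMap X p ≫ limit.π (inclLT p ⋙ X) (op ⟨q, hq⟩) =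
    X.map (homOfLE hq.le).op := limit.lift_π _ _
  have h3 := congrArg (fun f => (f.f n).hom x) h2
  refine h3.symm.trans (Eq.trans ?_ h1)
  exact congrArg ((limit.π (inclLT p ⋙ X) (op ⟨q, hq⟩)).f n).hom hx

end ComplexOfFunctor


/-! ### Extension by zero, mapping cones and K-injective complexes -/

section Homological

variable {C D : Type*} [Category* C] [Category* D]

section

variable [HasZeroMorphisms C] [HasZeroMorphisms D] [HasZeroObject C] [HasZeroObject D]
  {ι ι' : Type*} {c : ComplexShape ι} {c' : ComplexShape ι'}
  (H : C ⥤ D) [H.PreservesZeroMorphisms] (K : HomologicalComplex C c) (e : c.Embedding c')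

/-- The comparison between the image of an extended complex and the extension of the image,
in each degree. -/
def mapExtendXIso : ∀ i : Option ι, H.obj (HomologicalComplex.extend.X K i) ≅
    HomologicalComplex.extend.X ((H.mapHomologicalComplex c).obj K) i
  | some _ => Iso.refl _
  | none => (H.map_isZero (HomologicalComplex.extend.isZero_X K rfl)).iso
      (HomologicalComplex.extend.isZero_X _ rfl)

lemma mapExtendXIso_hom_d (i j : Option ι) :
    (mapExtendXIso H K i).hom ≫
        HomologicalComplex.extend.d ((H.mapHomologicalComplex c).obj K) i j =
      H.map (HomologicalComplex.extend.d K i j) ≫ (mapExtendXIso H K j).hom :=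
  match i, j with
  | none, _ => (H.map_isZero (HomologicalComplex.extend.isZero_X K rfl)).eq_of_src _ _
  | some _, none => (HomologicalComplex.extend.isZero_X _ rfl).eq_of_tgt _ _
  | some _, some _ => (Category.id_comp _).trans (Category.comp_id _).symm

/-- A functor preserving zero morphisms commutes with the extension of complexes by zero. -/
def mapExtendIso : (H.mapHomologicalComplex c').obj (K.extend e) ≅
    ((H.mapHomologicalComplex c).obj K).extend e :=
  HomologicalComplex.Hom.isoOfComponents (fun i => mapExtendXIso H K (e.r i))
    (fun _ _ _ => mapExtendXIso_hom_d H K _ _)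

end

variable [Abelian C] [Abelian D]

lemma quasiIso_iff_acyclic_mappingCone {K L : CochainComplex C ℤ} (f : K ⟶ L) :
    QuasiIso f ↔ (CochainComplex.mappingCone f).Acyclic := by
  rw [← HomologicalComplex.mem_quasiIso_iff, ← HomotopyCategory.quotient_map_mem_quasiIso_iff,
    HomotopyCategory.quasiIso_eq_trW_subcategoryAcyclic,
    ← HomotopyCategory.quotient_obj_mem_subcategoryAcyclic_iff_acyclic]
  exact ObjectProperty.trW_iff_of_distinguished _ _
    (HomotopyCategory.mappingCone_triangleh_distinguished f)

/-- A morphism to a K-injective complex extends along a quasi-isomorphism up to homotopy. -/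
lemma exists_homotopy_extension {K L I : CochainComplex C ℤ} [I.IsKInjective] (a : K ⟶ L)
    [ha : QuasiIso a] (b : K ⟶ I) : ∃ φ : L ⟶ I, Nonempty (Homotopy (a ≫ φ) b) := by
  have h := CochainComplex.IsKInjective.rightOrthogonal I
  -- Orthogonality to acyclic complexes means that precomposition with a quasi-isomorphism is
  -- bijective on homotopy classes of maps to `I`; surjectivity gives `φ`.
  rw [← ObjectProperty.isLocal_trW, ← HomotopyCategory.quasiIso_eq_trW_subcategoryAcyclic] at h
  obtain ⟨α, hα⟩ := (h _ ((HomotopyCategory.quotient_map_mem_quasiIso_iff a).2 ha)).2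
    ((HomotopyCategory.quotient _ _).map b)
  obtain ⟨φ, rfl⟩ := (HomotopyCategory.quotient _ _).map_surjective α
  exact ⟨φ, ⟨HomotopyCategory.homotopyOfEq _ _
    (((HomotopyCategory.quotient _ _).map_comp a φ).trans hα)⟩⟩

lemma exists_quasiIso_extension {K L I : CochainComplex C ℤ} [I.IsKInjective] (a : K ⟶ L)
    [QuasiIso a] (b : K ⟶ I) [QuasiIso b] : ∃ φ : L ⟶ I, QuasiIso φ := by
  obtain ⟨φ, ⟨h⟩⟩ := exists_homotopy_extension a b
  have : QuasiIso (a ≫ φ) := by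
    rw [quasiIso_iff]
    intro n
    rw [quasiIsoAt_iff_isIso_homologyMap, h.homologyMap_eq n]
    infer_instance
  exact ⟨φ, quasiIso_of_comp_left a φ⟩

end Homological

/-! ### Comparison with an injective resolution -/

variable {P : Type u} [PartialOrder P] {R : Type u} [CommRing R]

lemma isFlasque_mappingCone_X {K L : CochainComplex (Pᵒᵖ ⥤ ModuleCat.{u} R) ℤ} (f : K ⟶ L)
    (hK : ∀ n, IsFlasque (K.X n)) (hL : ∀ n, IsFlasque (L.X n)) (n : ℤ) :
    IsFlasque ((CochainComplex.mappingCone f).X n) :=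
  (hK (n + 1)).of_decomposition (hL n) _ _ _ _
    (CochainComplex.mappingCone.id_X f n (n + 1) rfl)

/-- The limit functor preserves quasi-isomorphisms between complexes of flasque presheaves. -/
lemma quasiIso_lim_map [WellFoundedLT P] {K L : CochainComplex (Pᵒᵖ ⥤ ModuleCat.{u} R) ℤ}
    (f : K ⟶ L) [QuasiIso f] (hK : ∀ n, IsFlasque (K.X n)) (hL : ∀ n, IsFlasque (L.X n)) :
    QuasiIso (((lim : (Pᵒᵖ ⥤ ModuleCat.{u} R) ⥤ _).mapHomologicalComplex _).map f) := by
  rw [quasiIso_iff_acyclic_mappingCone]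
  -- The additive functor `lim` commutes with mapping cones.
  exact fun n => (acyclic_lim (isFlasque_mappingCone_X f hK hL)
    ((quasiIso_iff_acyclic_mappingCone f).1 inferInstance) n).of_iso
      (CochainComplex.mappingCone.mapHomologicalComplexIso f lim)

/-- The homology of the limit of a fibrant replacement is computed by an injective resolution. -/
lemma nonempty_limit_homology_iso [WellFoundedLT P] {F : Pᵒᵖ ⥤ ModuleCat.{u} R}
    {RF : Pᵒᵖ ⥤ Ch R} {ι : inDegreeZero F ⟶ RF} (hι : IsFibrantReplacement ι)
    (I : InjectiveResolution F) (n : ℤ) :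
    Nonempty ((limit RF).homology n ≅
      (((lim.mapHomologicalComplex _).obj I.cocomplex).extend
        ComplexShape.embeddingUpNat).homology n) := by
  have := quasiIso_complexOfFunctorMap ι hι.weakEquivalence
  let b : (HomologicalComplex.single _ (ComplexShape.up ℤ) 0).obj F ⟶ I.cochainComplex := I.ι'
  have hb : QuasiIso b := inferInstanceAs (QuasiIso I.ι')
  obtain ⟨φ, hφ⟩ := exists_quasiIso_extension
    (singleToComplexOfFunctor F ≫ complexOfFunctorMap ι) b
  have := quasiIso_lim_map φ (isFlasque_complexOfFunctor_X RF hι.isFibrant)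
    (fun n => isFlasque_of_injective _)
  exact ⟨(HomologicalComplex.homologyFunctor _ _ n).mapIso (limitIso RF).symm ≪≫
    isoOfQuasiIsoAt ((lim.mapHomologicalComplex _).map φ) n ≪≫
    (HomologicalComplex.homologyFunctor _ _ n).mapIso
      (mapExtendIso lim I.cocomplex ComplexShape.embeddingUpNat)⟩

end HigherLim

end

theorem mainTheorem1 {P : Type u} [PartialOrder P] (hP : HigherLim.IsFilteredPoset P)
    {R : Type u} [CommRing R] (F : Pᵒᵖ ⥤ ModuleCat.{u} R)
    (RF : Pᵒᵖ ⥤ HigherLim.Ch R) (ι : HigherLim.inDegreeZero F ⟶ RF)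
    (hι : HigherLim.IsFibrantReplacement ι) :
    (∀ n : ℕ, Nonempty (HigherLim.higherLimit F n ≅ (limit RF).homology (n : ℤ))) ∧
      (∀ n : ℤ, n < 0 → IsZero ((limit RF).homology n)) := by
  obtain ⟨d, hd⟩ := hP
  have : WellFoundedLT P := hd.wellFoundedLT
  let I := InjectiveResolution.of F
  refine ⟨fun n => ?_, fun n hn => ?_⟩
  · obtain ⟨e⟩ := HigherLim.nonempty_limit_homology_iso hι I n
    exact ⟨I.isoRightDerivedObj lim n ≪≫
      (HomologicalComplex.extendHomologyIso _ ComplexShape.embeddingUpNat rfl).symm ≪≫ e.symm⟩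
  · obtain ⟨e⟩ := HigherLim.nonempty_limit_homology_iso hι I n
    refine IsZero.of_iso ?_ e
    -- Negative degrees lie outside the image of `ℕ`, where the extended complex is zero.
    refine (HomologicalComplex.exactAt_iff_isZero_homology _ _).1
      (HomologicalComplex.extend_exactAt _ _ _ fun j hj => ?_)
    have : (j : ℤ) = n := hj
    lia
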